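/- Let $H$ be a real separable Hilbert space with Borel $\sigma$-algebra $\mathcal B(H)$. Let $C : H \to H$ be a bounded, self-adjoint, non-negative, trace-class operator, let $C^{1/2}$ be its unique self-adjoint non-negative square root, and let $\nu = N(0,C)$ be the centered Gaussian measure on $H$ with covariance operator $C$. Let $\mu$ be any probability measure on $(H,\mathcal B(H))$, and let $A : H \to H$ be a linear operator, measurable with respect to the $\mu$-completion of $\mathcal B(H)$ (for example, bounded), such that $A(H) \subseteq C^{1/2}(H)$. Write $\mu\circ A^{-1}$ for the push-forward of $\mu$ under $A$. Then the convolution $\nu * (\mu\circ A^{-1})$, which is the law of $Au+\eta$ for independent $u\sim\mu$ and $\eta\sim\nu$, is equivalent to $\nu$, that is, $$\nu * (\mu\circ A^{-1}) \ll \nu \quad\text{and}\quad \nu \ll \nu * (\mu\circ A^{-1}).$$ -/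

import Mathlib

open MeasureTheory ProbabilityTheory Filter Topology
open scoped RealInnerProductSpace

namespace GaussianConvolution

universe u

set_option linter.unusedSectionVars false

variable {H : Type u} [NormedAddCommGroup H] [InnerProductSpace ℝ H] [CompleteSpace H]

/-- A symmetric positive operator with quadratic form at most `‖u‖ ^ 2` is a contraction. -/
theorem norm_le_one_of_inner_le (T : H →L[ℝ] H) (hT : T.IsPositive)
    (h : ∀ u, ⟪T u, u⟫ ≤ ‖u‖ ^ 2) : ‖T‖ ≤ 1 := by
  rw [T.norm_eq_iSup_rayleighQuotient hT.isSymmetric]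
  refine ciSup_le fun x => ?_
  have h0 : 0 ≤ ⟪T x, x⟫ := hT.inner_nonneg_left x
  have : T.rayleighQuotient x = ⟪T x, x⟫ / ‖x‖ ^ 2 := by
    simp [ContinuousLinearMap.rayleighQuotient, ContinuousLinearMap.reApplyInnerSelf]
  rw [this, abs_of_nonneg (by positivity)]
  exact div_le_one_of_le₀ (h x) (by positivity)

/-- The iteration `X ↦ (T + X ^ 2) / 2`, started at `0`; its limit is `1 - (1 - T) ^ (1 / 2)`. -/
noncomputable def sqrtIter (T : H →L[ℝ] H) : ℕ → H →L[ℝ] H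
  | 0 => 0
  | n + 1 => (2⁻¹ : ℝ) • (T + sqrtIter T n * sqrtIter T n)

/-- The scalar version of the iteration, at `T = 1`. -/
noncomputable def scalarIter : ℕ → ℝ
  | 0 => 0
  | n + 1 => 2⁻¹ * (1 + scalarIter n * scalarIter n)

theorem scalarIter_bounds (n : ℕ) : 0 ≤ scalarIter n ∧ scalarIter n ≤ 1 := by
  induction n with
  | zero => simp [scalarIter]
  | succ n ih => constructor <;> simp only [scalarIter] <;> nlinarith [ih.1, ih.2]

theorem scalarIter_mono : Monotone scalarIter :=
  monotone_nat_of_le_succ fun n => by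
    simp only [scalarIter]; nlinarith [sq_nonneg (scalarIter n - 1)]

theorem norm_sqrtIter_le (T : H →L[ℝ] H) (hT : ‖T‖ ≤ 1) (n : ℕ) :
    ‖sqrtIter T n‖ ≤ scalarIter n := by
  induction n with
  | zero => simp [sqrtIter, scalarIter]
  | succ n ih =>
    simp only [sqrtIter, scalarIter]
    rw [norm_smul, Real.norm_of_nonneg (by norm_num)]
    have h1 := norm_add_le T (sqrtIter T n * sqrtIter T n)
    have h2 := norm_mul_le (sqrtIter T n) (sqrtIter T n)
    have h3 := mul_le_mul ih ih (norm_nonneg _) (scalarIter_bounds n).1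
    linarith

theorem norm_sqrtIter_sub_le (T : H →L[ℝ] H) (hT : ‖T‖ ≤ 1) (n : ℕ) :
    ‖sqrtIter T (n + 1) - sqrtIter T n‖ ≤ scalarIter (n + 1) - scalarIter n := by
  induction n with
  | zero =>
    simp only [sqrtIter, scalarIter, mul_zero, add_zero, sub_zero, mul_one]
    rw [norm_smul, Real.norm_of_nonneg (by norm_num)]
    linarith
  | succ n ih =>
    have e : sqrtIter T (n + 2) - sqrtIter T (n + 1) = (2⁻¹ : ℝ) •
        (sqrtIter T (n + 1) * (sqrtIter T (n + 1) - sqrtIter T n) +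
          (sqrtIter T (n + 1) - sqrtIter T n) * sqrtIter T n) := by
      have h1 : sqrtIter T (n + 2) = (2⁻¹ : ℝ) • (T + sqrtIter T (n + 1) * sqrtIter T (n + 1)) :=
        rfl
      have h2 : sqrtIter T (n + 1) = (2⁻¹ : ℝ) • (T + sqrtIter T n * sqrtIter T n) := rfl
      have h3 : sqrtIter T (n + 2) - sqrtIter T (n + 1) = (2⁻¹ : ℝ) •
          (sqrtIter T (n + 1) * sqrtIter T (n + 1) - sqrtIter T n * sqrtIter T n) := by
        rw [h1]
        generalize sqrtIter T (n + 1) * sqrtIter T (n + 1) = Y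
        rw [h2, ← smul_sub]
        congr 1
        abel
      rw [h3]
      congr 1
      noncomm_ring
    have e' : scalarIter (n + 2) - scalarIter (n + 1) = 2⁻¹ *
        (scalarIter (n + 1) * (scalarIter (n + 1) - scalarIter n) +
          (scalarIter (n + 1) - scalarIter n) * scalarIter n) := by
      simp only [scalarIter]; ring
    rw [show n + 1 + 1 = n + 2 from rfl, e, e', norm_smul, Real.norm_of_nonneg (by norm_num)]
    refine mul_le_mul_of_nonneg_left ((norm_add_le _ _).trans (add_le_add ?_ ?_)) (by norm_num)
    · exact (norm_mul_le _ _).trans (mul_le_mul (norm_sqrtIter_le T hT _) ih (norm_nonneg _)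
        (scalarIter_bounds _).1)
    · exact (norm_mul_le _ _).trans (mul_le_mul ih (norm_sqrtIter_le T hT _) (norm_nonneg _)
        (sub_nonneg.2 (scalarIter_mono (Nat.le_succ n))))

theorem isSelfAdjoint_sqrtIter (T : H →L[ℝ] H) (hT : IsSelfAdjoint T) (n : ℕ) :
    IsSelfAdjoint (sqrtIter T n) := by
  induction n with
  | zero => exact IsSelfAdjoint.zero _
  | succ n ih =>
    refine IsSelfAdjoint.smul (IsSelfAdjoint.all _) (hT.add ?_)
    exact (ih.commute_iff ih).1 (Commute.refl _)

theorem commute_sqrtIter (T B : H →L[ℝ] H) (hB : Commute B T) (n : ℕ) :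
    Commute B (sqrtIter T n) := by
  induction n with
  | zero => exact Commute.zero_right _
  | succ n ih => exact (hB.add_right (ih.mul_right ih)).smul_right _

/-- Existence of a positive square root that commutes with the commutant, for contractions. -/
theorem exists_sqrt_of_norm_le_one (C : H →L[ℝ] H) (hC : C.IsPositive) (h1 : ‖C‖ ≤ 1) :
    ∃ S : H →L[ℝ] H, S.IsPositive ∧ S * S = C ∧ ∀ B, Commute B C → Commute B S := by
  set T : H →L[ℝ] H := 1 - C with hTdef
  have hCle (x : H) : ⟪C x, x⟫ ≤ ‖x‖ ^ 2 := by
    have h2 : ‖C x‖ ≤ ‖x‖ := by simpa using C.le_of_opNorm_le h1 x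
    nlinarith [real_inner_le_norm (C x) x, norm_nonneg x]
  have hTsa : IsSelfAdjoint T := (IsSelfAdjoint.one _).sub hC.isSelfAdjoint
  have hTx (x : H) : ⟪T x, x⟫ = ‖x‖ ^ 2 - ⟪C x, x⟫ := by
    simp [hTdef, inner_sub_left]
  have hTpos : T.IsPositive := by
    refine (ContinuousLinearMap.isPositive_iff' T).2 ⟨hTsa, fun x => ?_⟩
    rw [hTx]; linarith [hCle x]
  have hTn : ‖T‖ ≤ 1 := norm_le_one_of_inner_le T hTpos fun x => by
    have : 0 ≤ ⟪C x, x⟫ := hC.inner_nonneg_left x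
    rw [hTx]; linarith
  have hsum : Summable fun n => scalarIter (n + 1) - scalarIter n := by
    refine summable_of_sum_range_le (c := 1)
      (fun n => sub_nonneg.2 (scalarIter_mono (Nat.le_succ n))) fun n => ?_
    rw [Finset.sum_range_sub]
    simpa [scalarIter] using (scalarIter_bounds n).2
  have hcau : CauchySeq (sqrtIter T) :=
    cauchySeq_of_dist_le_of_summable _ (fun n => by
      rw [dist_comm, dist_eq_norm]; exact norm_sqrtIter_sub_le T hTn n) hsum
  obtain ⟨X, hX⟩ := cauchySeq_tendsto_of_complete hcau
  have hfix : X = (2⁻¹ : ℝ) • (T + X * X) := by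
    refine tendsto_nhds_unique ((tendsto_add_atTop_iff_nat 1).2 hX) ?_
    exact (tendsto_const_nhds.add (hX.mul hX)).const_smul (2⁻¹ : ℝ)
  have hXsa : IsSelfAdjoint X :=
    tendsto_nhds_unique (((continuous_star.tendsto X).comp hX).congr
      fun n => (isSelfAdjoint_sqrtIter T hTsa n).star_eq) hX
  have hXn : ‖X‖ ≤ 1 := le_of_tendsto hX.norm (Eventually.of_forall fun n =>
    (norm_sqrtIter_le T hTn n).trans (scalarIter_bounds n).2)
  refine ⟨1 - X, ?_, ?_, fun B hB => ?_⟩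
  · refine (ContinuousLinearMap.isPositive_iff' _).2 ⟨(IsSelfAdjoint.one _).sub hXsa, fun x => ?_⟩
    have h2 : ‖X x‖ ≤ ‖x‖ := by simpa using X.le_of_opNorm_le hXn x
    have h3 : ⟪(1 - X) x, x⟫ = ‖x‖ ^ 2 - ⟪X x, x⟫ := by simp [inner_sub_left]
    rw [h3]
    nlinarith [real_inner_le_norm (X x) x, norm_nonneg x]
  · have h2 : (2 : ℝ) • X = T + X * X := by
      nth_rewrite 1 [hfix]; rw [smul_smul]; norm_num
    have h3 : (1 - X) * (1 - X) = 1 - (2 : ℝ) • X + X * X := by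
      rw [two_smul]; noncomm_ring
    rw [h3, h2, hTdef]; abel
  · have hBT : Commute B T := (Commute.one_right B).sub_right hB
    have hBX : Commute B X :=
      tendsto_nhds_unique ((hX.const_mul B).congr fun n => commute_sqrtIter T B hBT n)
        (hX.mul_const B)
    exact (Commute.one_right B).sub_right hBX

/-- A positive bounded operator on a real Hilbert space has exactly one positive square root. -/
theorem existsUnique_sqrt (C : H →L[ℝ] H) (hC : C.IsPositive) :
    ∃! S : H →L[ℝ] H, S.IsPositive ∧ S * S = C := by
  obtain ⟨S, hS, hSC, hcomm⟩ : ∃ S : H →L[ℝ] H, S.IsPositive ∧ S * S = C ∧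
      ∀ B, Commute B C → Commute B S := by
    set c : ℝ := ‖C‖ + 1 with hc
    have hc0 : 0 < c := by positivity
    obtain ⟨S, hS, hSC, hcomm⟩ := exists_sqrt_of_norm_le_one (c⁻¹ • C)
      (hC.smul_of_nonneg (inv_nonneg.2 hc0.le)) (by
        rw [norm_smul, Real.norm_of_nonneg (inv_nonneg.2 hc0.le), inv_mul_le_one₀ hc0]
        linarith)
    refine ⟨√c • S, hS.smul_of_nonneg (Real.sqrt_nonneg c), ?_, fun B hB =>
      (hcomm B (hB.smul_right _)).smul_right _⟩
    rw [smul_mul_smul_comm, hSC, Real.mul_self_sqrt hc0.le, smul_smul, mul_inv_cancel₀ hc0.ne',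
      one_smul]
  refine ⟨S, ⟨hS, hSC⟩, ?_⟩
  rintro B ⟨hB, hBC⟩
  have hBS : B * S = S * B := hcomm B (by rw [← hBC]; exact (Commute.refl B).mul_right (.refl B))
  ext x
  set y : H := (B - S) x with hy
  have h0 : (B + S) y = 0 := by
    have h1 : (B + S) * (B - S) = 0 := by
      have h2 : (B + S) * (B - S) = B * B - B * S + S * B - S * S := by noncomm_ring
      rw [h2, hBC, hSC, hBS]; abel
    simpa [hy] using congrArg (fun R : H →L[ℝ] H => R x) h1
  have key (P : H →L[ℝ] H) (hP : P.IsPositive) (hPy : ⟪P y, y⟫ = 0) : P y = 0 := by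
    -- Cauchy-Schwarz for the positive form, in its quadratic version.
    have hq (t : ℝ) : 0 ≤ 2 * t * ‖P y‖ ^ 2 + t ^ 2 * ⟪P (P y), P y⟫ := by
      have h1 : 0 ≤ ⟪P (y + t • P y), y + t • P y⟫ := hP.inner_nonneg_left _
      have h2 : ⟪P (P y), y⟫ = ‖P y‖ ^ 2 := by
        rw [hP.inner_left_eq_inner_right, real_inner_self_eq_norm_sq]
      simp only [map_add, map_smul, inner_add_left, inner_add_right, real_inner_smul_left,
        real_inner_smul_right, hPy, h2, real_inner_self_eq_norm_sq] at h1
      linarith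
    have hnn : 0 ≤ ⟪P (P y), P y⟫ := hP.inner_nonneg_left _
    set a := ‖P y‖ ^ 2 with ha
    set b : ℝ := ⟪P (P y), P y⟫ with hb
    have ha0 : 0 ≤ a := by positivity
    have h3 := hq (-a / (b + 1))
    have hb1 : 0 < b + 1 := by linarith
    have h4 : 2 * (-a / (b + 1)) * a + (-a / (b + 1)) ^ 2 * b
        = -(a ^ 2 * (b + 2)) / (b + 1) ^ 2 := by
      field_simp; ring
    rw [h4, neg_div] at h3
    have h5 : a ^ 2 * (b + 2) / (b + 1) ^ 2 ≤ 0 := by linarith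
    have h6 : a = 0 := by
      by_contra hne
      have : 0 < a ^ 2 * (b + 2) / (b + 1) ^ 2 := by positivity
      linarith
    exact norm_eq_zero.1 (pow_eq_zero_iff (two_ne_zero) |>.1 h6)
  have hB0 : 0 ≤ ⟪B y, y⟫ := hB.inner_nonneg_left y
  have hS0 : 0 ≤ ⟪S y, y⟫ := hS.inner_nonneg_left y
  have hsum : ⟪B y, y⟫ + ⟪S y, y⟫ = 0 := by
    rw [← inner_add_left, ← add_apply, h0, inner_zero_left]
  have hBy := key B hB (by linarith)
  have hSy := key S hS (by linarith)
  have hyy : ‖y‖ ^ 2 = 0 := by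
    have h1 : ⟪y, (B - S) x⟫ = ⟪(B - S) y, x⟫ := by
      simp only [sub_apply, inner_sub_left, inner_sub_right,
        hB.inner_left_eq_inner_right, hS.inner_left_eq_inner_right]
    rw [← real_inner_self_eq_norm_sq]
    nth_rewrite 2 [hy]
    rw [h1]
    simp [hBy, hSy]
  have : y = 0 := norm_eq_zero.1 (pow_eq_zero_iff two_ne_zero |>.1 hyy)
  simpa [hy, sub_eq_zero] using this

open scoped Classical in
/-- The square root `C ^ (1 / 2)`: for a self-adjoint non-negative operator `C`, the unique
self-adjoint non-negative `S` with `S * S = C`; set to `0` if `C` is not of that kind. -/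
noncomputable def opSqrt (C : H →L[ℝ] H) : H →L[ℝ] H :=
  if hC : C.IsPositive then (existsUnique_sqrt C hC).choose else 0

theorem opSqrt_spec (C : H →L[ℝ] H) (hC : C.IsPositive) :
    (opSqrt C).IsPositive ∧ opSqrt C * opSqrt C = C := by
  rw [opSqrt, dif_pos hC]
  exact (existsUnique_sqrt C hC).choose_spec.1

theorem opSqrt_unique (C S : H →L[ℝ] H) (hS : S.IsPositive) (hSC : S * S = C)
    (hC : C.IsPositive) : opSqrt C = S :=
  (existsUnique_sqrt C hC).unique (opSqrt_spec C hC) ⟨hS, hSC⟩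

/-- Trace class, for self-adjoint non-negative operators: the trace `∑ j, ⟪C (φ j), φ j⟫` is
finite in every orthonormal basis. -/
def IsTraceClass (C : H →L[ℝ] H) : Prop :=
  ∀ (ι : Type u) (φ : HilbertBasis ι ℝ H), Summable fun j => ⟪C (φ j), φ j⟫

/-- `ν = N(0, C)`: the measure `ν` is Gaussian (every continuous linear functional has a real
Gaussian law), has mean `0`, and has covariance operator `C`. -/
structure IsCenteredGaussian [MeasurableSpace H] [BorelSpace H]
    (ν : Measure H) (C : H →L[ℝ] H) : Prop where
  isGaussian : IsGaussian ν
  mean_eq_zero : ∫ x, x ∂ν = 0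
  covariance_eq : ∀ x y : H, covarianceBilin ν x y = ⟪C x, y⟫

/-- Equivalence `μ ∼ ν` of measures: mutual absolute continuity. -/
def MeasureEquivalent {X : Type*} [MeasurableSpace X] (μ ν : Measure X) : Prop :=
  μ ≪ ν ∧ ν ≪ μ

end GaussianConvolution

/-!
The convolution evaluates on a Borel set `B` as `∫ ν (B - A u) dμ(u)`, and every `A u` lies in the
Cameron–Martin space `range (C ^ (1 / 2))`. It therefore suffices that translation by an element
`h = C ^ (1 / 2) w` of that space preserves the `ν`-null sets; applying this to `h` and `-h`, the
null sets of `ν` and of its translate coincide, and integrating over `μ` gives both directions.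

For `h = C x` the translate is the exponential tilting of `ν` by `⟪x, ·⟫`
(`IsCenteredGaussian.tilted_inner_eq_map_add`), since the two have the same one-dimensional moment
generating functions. The Cauchy–Schwarz inequality turns the explicit density into
`ν (B - C x) ≤ exp (‖C ^ (1 / 2) x‖ ^ 2 / 2) * ν B ^ (1 / 2)`
(`IsCenteredGaussian.map_add_apply_le`).

A general `h` has the form `C ^ (1 / 2) w` with `w` in the closed range of `C ^ (1 / 2)`, so it is a
limit of vectors `C (x n)` along which `‖C ^ (1 / 2) (x n)‖` stays bounded. By Fatou's lemma the
inequality passes to the limit on open sets, and outer regularity of `ν` concludes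
(`IsCenteredGaussian.map_add_absolutelyContinuous`). This replaces the explicit Cameron–Martin
density for `h`, and with it the construction of the measurable linear functional associated
with `w`.
-/

namespace GaussianConvolution

universe u

variable {H : Type u} [NormedAddCommGroup H] [InnerProductSpace ℝ H] [CompleteSpace H]

/-! ### Approximation inside the range of a positive operator -/

/-- Every element of the range of a positive operator `S` is the image of a limit of elements
of that range, because `S` vanishes on the orthogonal complement of its range. -/
theorem exists_seq_tendsto_of_mem_range {S : H →L[ℝ] H} (hS : S.IsPositive) {h : H}
    (hh : h ∈ Set.range S) :
    ∃ (x : ℕ → H) (w : H), Tendsto (fun n => S (x n)) atTop (𝓝 w) ∧ S w = h := by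
  obtain ⟨v, rfl⟩ := hh
  set K : Submodule ℝ H := S.range.topologicalClosure
  have : CompleteSpace K := S.range.isClosed_topologicalClosure.completeSpace_coe
  obtain ⟨w, hw, p, hp, rfl⟩ := K.exists_add_mem_mem_orthogonal v
  have hSp : S p = 0 := by
    have h1 : ⟪S (S p), p⟫ = 0 :=
      hp _ (S.range.le_topologicalClosure ⟨S p, rfl⟩)
    rw [hS.inner_left_eq_inner_right] at h1
    exact inner_self_eq_zero.1 h1
  obtain ⟨y, hy, hyw⟩ := mem_closure_iff_seq_limit.1 (show w ∈ closure (S.range : Set H) from hw)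
  choose x hx using hy
  refine ⟨x, w, hyw.congr fun n => (hx n).symm, ?_⟩
  rw [map_add, hSp, add_zero]

variable [MeasurableSpace H] [BorelSpace H] {ν : Measure H} {C : H →L[ℝ] H}

/-! ### Exponential moments and translations by the range of the covariance operator -/

theorem IsCenteredGaussian.mgf_inner [SecondCountableTopology H] (hν : IsCenteredGaussian ν C)
    (x : H) (t : ℝ) :
    mgf (fun z => ⟪x, z⟫) ν t = Real.exp (t ^ 2 * ⟪C x, x⟫ / 2) := by
  have := hν.isGaussian
  have hmap := IsGaussian.map_eq_gaussianReal (μ := ν) (innerSL ℝ x)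
  have hvar : Var[innerSL ℝ x; ν] = ⟪C x, x⟫ := by
    rw [← hν.covariance_eq, covarianceBilin_self IsGaussian.memLp_two_id]
    rfl
  rw [IsGaussian.integral_dual, hν.mean_eq_zero, map_zero] at hmap
  have h := mgf_gaussianReal hmap t
  rw [Real.coe_toNNReal _ (variance_nonneg _ _), hvar] at h
  change mgf (innerSL ℝ x) ν t = _
  rw [h]
  ring_nf

theorem IsCenteredGaussian.integral_exp_inner [SecondCountableTopology H]
    (hν : IsCenteredGaussian ν C) (x : H) :
    ∫ z, Real.exp ⟪x, z⟫ ∂ν = Real.exp (⟪C x, x⟫ / 2) := by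
  simpa [mgf] using hν.mgf_inner x 1

theorem IsCenteredGaussian.integrable_exp_inner [SecondCountableTopology H]
    (hν : IsCenteredGaussian ν C) (x : H) :
    Integrable (fun z => Real.exp ⟪x, z⟫) ν := by
  refine Integrable.of_integral_ne_zero ?_
  rw [hν.integral_exp_inner]
  exact (Real.exp_pos _).ne'

/-- Two probability measures agree if every `⟪t, ·⟫` has the same moment generating function under
both: the characteristic functions then agree by analytic continuation. A nonzero value of `mgf`
encodes finiteness, since the integral of a non-integrable function is `0`. -/
theorem measure_ext_of_mgf_inner [SecondCountableTopology H] {ρ ρ' : Measure H} [IsProbabilityMeasure ρ]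
    [IsProbabilityMeasure ρ'] (hne : ∀ (t : H) (s : ℝ), mgf (fun z => ⟪t, z⟫) ρ s ≠ 0)
    (h : ∀ (t : H) (s : ℝ), mgf (fun z => ⟪t, z⟫) ρ s = mgf (fun z => ⟪t, z⟫) ρ' s) :
    ρ = ρ' := by
  refine Measure.ext_of_charFun (funext fun t => ?_)
  have hset : integrableExpSet (fun z => ⟪t, z⟫) ρ = Set.univ :=
    Set.eq_univ_of_forall fun s => Integrable.of_integral_ne_zero (hne t s)
  have key := eqOn_complexMGF_of_mgf (funext (h t)) (x := Complex.I) (by simp [hset])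
  simpa [complexMGF, charFun_apply, real_inner_comm, mul_comm] using key

/-- Translating `N(0, C)` by `C x` amounts to tilting it by the exponential of `⟪x, ·⟫`. -/
theorem IsCenteredGaussian.tilted_inner_eq_map_add [SecondCountableTopology H]
    (hν : IsCenteredGaussian ν C) (hC : C.IsPositive) (x : H) :
    ν.tilted (fun z => ⟪x, z⟫) = ν.map (· + C x) := by
  have := hν.isGaussian
  have : IsProbabilityMeasure (ν.tilted (fun z => ⟪x, z⟫)) :=
    isProbabilityMeasure_tilted (hν.integrable_exp_inner x)
  have : IsProbabilityMeasure (ν.map (· + C x)) :=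
    Measure.isProbabilityMeasure_map (by fun_prop)
  have htilt (t : H) (s : ℝ) : mgf (fun z => ⟪t, z⟫) (ν.tilted fun z => ⟪x, z⟫) s
      = Real.exp (s * ⟪C x, t⟫ + s ^ 2 * ⟪C t, t⟫ / 2) := by
    have h1 : ((fun z => ⟪x, z⟫) + fun z => s * ⟪t, z⟫) = fun z => ⟪x + s • t, z⟫ := by
      ext z; simp [inner_add_left, real_inner_smul_left]
    have hsymm : ⟪C t, x⟫ = ⟪C x, t⟫ := by
      rw [hC.inner_left_eq_inner_right, real_inner_comm]
    rw [mgf, integral_exp_tilted, h1, hν.integral_exp_inner, hν.integral_exp_inner,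
      ← Real.exp_sub]
    congr 1
    simp only [map_add, map_smul, inner_add_left, inner_add_right, real_inner_smul_left,
      real_inner_smul_right, hsymm]
    ring
  refine measure_ext_of_mgf_inner (fun t s => ?_) fun t s => ?_
  · rw [htilt]; exact (Real.exp_pos _).ne'
  · rw [htilt, mgf, integral_map (by fun_prop) (by fun_prop)]
    simp only [inner_add_right, mul_add, Real.exp_add, integral_mul_const]
    rw [← mgf, hν.mgf_inner, mul_comm, real_inner_comm t (C x)]

/-- The Cauchy–Schwarz inequality for the indicator of `B` and the density of the translate, whose
`L²(ν)` norm is `exp (⟪C x, x⟫ / 2)`. -/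
theorem IsCenteredGaussian.map_add_apply_le [SecondCountableTopology H]
    (hν : IsCenteredGaussian ν C) (hC : C.IsPositive) (x : H) {B : Set H} (hB : MeasurableSet B) :
    ν.map (· + C x) B ≤ ENNReal.ofReal (Real.exp (⟪C x, x⟫ / 2)) * ν B ^ (1 / 2 : ℝ) := by
  set q : ℝ := ⟪C x, x⟫ with hq
  have hsq : ∫⁻ z, ENNReal.ofReal (Real.exp ⟪x, z⟫ / Real.exp (q / 2)) ^ (2 : ℝ) ∂ν
      = ENNReal.ofReal (Real.exp q) := by
    have h1 (z : H) : ENNReal.ofReal (Real.exp ⟪x, z⟫ / Real.exp (q / 2)) ^ (2 : ℝ)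
        = ENNReal.ofReal (Real.exp ⟪(2 : ℝ) • x, z⟫ * Real.exp (-q)) := by
      rw [← Real.exp_sub, ENNReal.ofReal_rpow_of_pos (Real.exp_pos _), ← Real.exp_mul,
        real_inner_smul_left, ← Real.exp_add]
      congr 2
      ring
    simp_rw [h1]
    rw [← ofReal_integral_eq_lintegral_ofReal
      ((hν.integrable_exp_inner _).mul_const _) (ae_of_all _ fun z => by positivity),
      integral_mul_const, hν.integral_exp_inner, ← Real.exp_add]
    congr 2
    simp only [map_smul, real_inner_smul_left, real_inner_smul_right, ← hq]
    ring
  rw [← hν.tilted_inner_eq_map_add hC, tilted_apply' _ _ hB, hν.integral_exp_inner,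
    ← lintegral_indicator hB]
  calc ∫⁻ z, B.indicator (fun z => ENNReal.ofReal (Real.exp ⟪x, z⟫ / Real.exp (q / 2))) z ∂ν
      = ∫⁻ z, ((fun z => ENNReal.ofReal (Real.exp ⟪x, z⟫ / Real.exp (q / 2)))
          * B.indicator (1 : H → ENNReal)) z ∂ν := by
        congr 1 with z
        by_cases hz : z ∈ B <;> simp [hz]
    _ ≤ _ := ENNReal.lintegral_mul_le_Lp_mul_Lq ν Real.HolderConjugate.two_two (by fun_prop)
        ((measurable_one.indicator hB).aemeasurable)
    _ = _ := by
        have h2 : ∫⁻ z, (B.indicator (1 : H → ENNReal) z) ^ (2 : ℝ) ∂ν = ν B := by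
          rw [← lintegral_indicator_one hB]
          congr 1 with z
          by_cases hz : z ∈ B <;> simp [hz]
        rw [hsq, h2, ENNReal.ofReal_rpow_of_pos (Real.exp_pos _), ← Real.exp_mul]
        congr 4
        ring

/-! ### Translations by the range of the square root of the covariance operator -/

/-- Quasi-invariance of `N(0, C)` under translation by its Cameron–Martin space. -/
theorem IsCenteredGaussian.map_add_absolutelyContinuous [SecondCountableTopology H]
    (hν : IsCenteredGaussian ν C) (hC : C.IsPositive) {h : H}
    (hh : h ∈ Set.range (opSqrt C)) : ν.map (· + h) ≪ ν := by
  have := hν.isGaussian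
  obtain ⟨hS, hSS⟩ := opSqrt_spec C hC
  set S := opSqrt C
  obtain ⟨x, w, hxw, rfl⟩ := exists_seq_tendsto_of_mem_range hS hh
  have hCx : Tendsto (fun n => C (x n)) atTop (𝓝 (S w)) := by
    rw [← hSS]
    exact (S.continuous.tendsto w).comp hxw
  obtain ⟨M, hM⟩ := hxw.norm.bddAbove_range
  have hq (n : ℕ) : ⟪C (x n), x n⟫ ≤ M ^ 2 := by
    have h1 : ⟪C (x n), x n⟫ = ‖S (x n)‖ ^ 2 := by
      rw [← hSS, mul_apply_eq_comp, hS.inner_left_eq_inner_right,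
        real_inner_self_eq_norm_sq]
    rw [h1]
    exact pow_le_pow_left₀ (norm_nonneg _) (hM ⟨n, rfl⟩) 2
  set K : ENNReal := ENNReal.ofReal (Real.exp (M ^ 2 / 2))
  -- The indicator of an open set is lower semicontinuous, so Fatou's lemma applies to its
  -- translates by `C (x n)`.
  have hopen (U : Set H) (hU : IsOpen U) : ν.map (· + S w) U ≤ K * ν U ^ (1 / 2 : ℝ) := by
    have hmeas (a : H) : Measurable fun z => U.indicator (1 : H → ENNReal) (z + a) :=
      (measurable_one.indicator hU.measurableSet).comp (measurable_add_const a)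
    have hval (a : H) : ν.map (· + a) U = ∫⁻ z, U.indicator 1 (z + a) ∂ν := by
      rw [← lintegral_indicator_one hU.measurableSet,
        lintegral_map (measurable_one.indicator hU.measurableSet) (by fun_prop)]
    have hlim (z : H) : U.indicator (1 : H → ENNReal) (z + S w)
        ≤ liminf (fun n => U.indicator (1 : H → ENNReal) (z + C (x n))) atTop := by
      by_cases hz : z + S w ∈ U
      · have hev : ∀ᶠ n in atTop, z + C (x n) ∈ U :=
          (hCx.const_add z).eventually (hU.mem_nhds hz)
        refine le_liminf_of_le (by isBoundedDefault) (hev.mono fun n hn => ?_)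
        simp [hz, hn]
      · simp [hz]
    calc ν.map (· + S w) U = ∫⁻ z, U.indicator 1 (z + S w) ∂ν := hval _
      _ ≤ ∫⁻ z, liminf (fun n => U.indicator 1 (z + C (x n))) atTop ∂ν :=
        lintegral_mono hlim
      _ ≤ liminf (fun n => ∫⁻ z, U.indicator 1 (z + C (x n)) ∂ν) atTop :=
        lintegral_liminf_le fun n => hmeas _
      _ ≤ K * ν U ^ (1 / 2 : ℝ) := by
        refine liminf_le_of_le (by isBoundedDefault) fun b hb => ?_
        obtain ⟨n, hn⟩ := hb.exists
        rw [← hval] at hn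
        refine hn.trans ((hν.map_add_apply_le hC (x n) hU.measurableSet).trans ?_)
        refine mul_le_mul_left (ENNReal.ofReal_le_ofReal (Real.exp_le_exp.2 ?_)) _
        linarith [hq n]
  refine fun B hB => le_antisymm (ENNReal.le_of_forall_pos_le_add fun ε hε _ => ?_) bot_le
  -- `δ` is chosen so that `K * δ ^ (1 / 2) = ε`.
  set δ : ENNReal := (ε / K) ^ (2 : ℝ)
  have hK0 : K ≠ 0 := by simp [K, Real.exp_pos]
  have hKt : K ≠ ⊤ := ENNReal.ofReal_ne_top
  have hδ : 0 < δ :=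
    ENNReal.rpow_pos (ENNReal.div_pos (by exact_mod_cast hε.ne') hKt)
      (ENNReal.div_lt_top ENNReal.coe_ne_top hK0).ne
  obtain ⟨U, hBU, hU, hUδ⟩ := B.exists_isOpen_lt_of_lt (μ := ν) δ (by rwa [hB])
  calc ν.map (· + S w) B ≤ ν.map (· + S w) U := measure_mono hBU
    _ ≤ K * ν U ^ (1 / 2 : ℝ) := hopen U hU
    _ ≤ K * δ ^ (1 / 2 : ℝ) := by gcongr
    _ = 0 + ε := by
      rw [← ENNReal.rpow_mul]
      norm_num
      exact ENNReal.mul_div_cancel hK0 hKt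

theorem IsCenteredGaussian.map_add_apply_eq_zero_iff [SecondCountableTopology H]
    (hν : IsCenteredGaussian ν C) (hC : C.IsPositive) {h : H}
    (hh : h ∈ Set.range (opSqrt C)) {B : Set H} (hB : MeasurableSet B) :
    ν.map (· + h) B = 0 ↔ ν B = 0 := by
  refine ⟨fun h0 => ?_, fun h0 => hν.map_add_absolutelyContinuous hC hh h0⟩
  have hneg : -h ∈ Set.range (opSqrt C) := by
    obtain ⟨w, rfl⟩ := hh
    exact ⟨-w, map_neg _ _⟩
  rw [Measure.map_apply (by fun_prop) hB] at h0
  have h1 := hν.map_add_absolutelyContinuous hC hneg h0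
  rw [Measure.map_apply (by fun_prop) (hB.preimage (by fun_prop))] at h1
  simpa [Set.preimage_preimage] using h1

end GaussianConvolution

/-! ### Convolutions with measures carried by the Cameron–Martin space -/

theorem mainTheorem2 {H : Type*} [NormedAddCommGroup H] [InnerProductSpace ℝ H] [CompleteSpace H]
    [TopologicalSpace.SeparableSpace H] [MeasurableSpace H] [BorelSpace H]
    (μ ν : Measure H) [IsProbabilityMeasure μ]
    (C : H →L[ℝ] H) (hC : C.IsPositive) (hCtr : GaussianConvolution.IsTraceClass C)
    (hν : GaussianConvolution.IsCenteredGaussian ν C)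
    (A : H →ₗ[ℝ] H) (hAmeas : AEMeasurable A μ)
    (hA : Set.range A ⊆ Set.range (GaussianConvolution.opSqrt C)) :
    GaussianConvolution.MeasureEquivalent (ν.conv (μ.map A)) ν := by
  have := hν.isGaussian
  have : SecondCountableTopology H := UniformSpace.secondCountable_of_separable H
  have : IsProbabilityMeasure (μ.map A) := Measure.isProbabilityMeasure_map hAmeas
  have hmeas {B : Set H} (hB : MeasurableSet B) : Measurable fun y => ν.map (· + y) B := by
    simp_rw [Measure.map_apply (measurable_add_const _) hB]
    exact measurable_measure_prodMk_right (measurable_add hB)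
  have hconv {B : Set H} (hB : MeasurableSet B) :
      ν.conv (μ.map A) B = ∫⁻ u, ν.map (· + A u) B ∂μ := by
    rw [← lintegral_map' (hmeas hB).aemeasurable hAmeas, Measure.conv,
      Measure.map_apply measurable_add hB, Measure.prod_apply_symm (measurable_add hB)]
    simp_rw [Measure.map_apply (measurable_add_const _) hB]
    rfl
  have hiff {B : Set H} (hB : MeasurableSet B) (u : H) : ν.map (· + A u) B = 0 ↔ ν B = 0 :=
    hν.map_add_apply_eq_zero_iff hC (hA ⟨u, rfl⟩) hB
  refine ⟨Measure.AbsolutelyContinuous.mk fun B hB h0 => ?_,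
    Measure.AbsolutelyContinuous.mk fun B hB h0 => ?_⟩
  · simp [hconv hB, (hiff hB _).2 h0]
  · rw [hconv hB] at h0
    obtain ⟨u, hu⟩ :=
      ((lintegral_eq_zero_iff' ((hmeas hB).comp_aemeasurable hAmeas)).1 h0).exists
    exact (hiff hB u).1 hu
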